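/- For a finite connected simple graph $G$ and a vertex $v$ let $\varepsilon(v)$ be the eccentricity of $v$ (the largest distance from $v$ to a vertex of $G$), $\deg(v)$ its degree, and $D(v)$ the sum of the distances from $v$ to all other vertices. Let $\xi^c(G)=\sum_{v\in V(G)}\varepsilon(v)\deg(v)$ be the eccentric connectivity index and $\xi^d(G)=\sum_{v\in V(G)}\varepsilon(v)D(v)$ the eccentric distance sum of $G$. Let $P_n$ be the path on $n$ vertices. **Theorem.** If $T$ is a tree of order $n$, then $$\xi^d(T)-\xi^c(T)\le\begin{cases}\frac{25n^4}{96}-\frac{n^3}{6}-\frac{89n^2}{48}+\frac{19n}{6}-\frac{45}{32}, & n\text{ odd},\\[4pt] \frac{25n^4}{96}-\frac{n^3}{6}-\frac{43n^2}{24}+\frac{19n}{6}-2, & n\text{ even},\end{cases}$$ and the right-hand side is equal to $\xi^d(P_n)-\xi^c(P_n)$. Moreover, equality holds in the inequality if and only if $T$ is isomorphic to $P_n$. -/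

import Mathlib

namespace EccDiff

/-- The eccentricity of a vertex as a natural number: the distance to a farthest vertex.
(On a finite connected graph `G.eccent v` is finite, see `ecc_eq_sup_dist`.) -/
noncomputable def ecc {V : Type*} (G : SimpleGraph V) (v : V) : ℕ :=
  (G.eccent v).toNat

/-- The total distance of `v`: the sum of the distances between `v` and the other vertices. -/
noncomputable def totalDist {V : Type*} [Fintype V] (G : SimpleGraph V) (v : V) : ℕ :=
  ∑ u, G.dist v u

/-- The eccentric connectivity index. -/
noncomputable def eccConnIndex {V : Type*} [Fintype V] (G : SimpleGraph V)
    [DecidableRel G.Adj] : ℕ :=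
  ∑ v, ecc G v * G.degree v

/-- The eccentric distance sum. -/
noncomputable def eccDistSum {V : Type*} [Fintype V] (G : SimpleGraph V) : ℕ :=
  ∑ v, ecc G v * totalDist G v

/-- The explicit quartic in the order `n`, with separate forms for odd and even `n`. -/
def quartic (n : ℕ) : ℚ :=
  if Odd n then
    25 * (n : ℚ) ^ 4 / 96 - (n : ℚ) ^ 3 / 6 - 89 * (n : ℚ) ^ 2 / 48 + 19 * (n : ℚ) / 6 - 45 / 32
  else
    25 * (n : ℚ) ^ 4 / 96 - (n : ℚ) ^ 3 / 6 - 43 * (n : ℚ) ^ 2 / 24 + 19 * (n : ℚ) / 6 - 2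

/-- Adjacency in the path graph `P_n` is decidable, so that its degrees can be written down. -/
instance pathGraphDecidableAdj (n : ℕ) : DecidableRel (SimpleGraph.pathGraph n).Adj :=
  fun _ _ => decidable_of_iff _ SimpleGraph.pathGraph_adj.symm

/-- On a finite connected graph the eccentricity is the maximum of the distances. -/
theorem ecc_eq_sup_dist {V : Type*} [Fintype V] (G : SimpleGraph V) (hG : G.Connected) (v : V) :
    ecc G v = Finset.univ.sup (fun u => G.dist v u) := by
  have h : G.eccent v = ((Finset.univ.sup (fun u => G.dist v u) : ℕ) : ℕ∞) := by
    apply le_antisymm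
    · refine iSup_le fun u => ?_
      rw [← (hG v u).coe_dist_eq_edist]
      exact_mod_cast Finset.le_sup (f := fun u => G.dist v u) (Finset.mem_univ u)
    · obtain ⟨u, -, hu⟩ := Finset.exists_mem_eq_sup Finset.univ ⟨v, Finset.mem_univ v⟩
        (fun u => G.dist v u)
      rw [hu, (hG v u).coe_dist_eq_edist]
      exact le_iSup (fun u => G.edist v u) u
  rw [ecc, h, ENat.toNat_natCast]

end EccDiff

namespace EccDiff

/-! Neighbours are the vertices at distance 1, so ξ^d − ξ^c = Σ ε(v)(D(v) − deg(v)) is the natural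
number `eccFarSum`. It is bounded by induction from n − 2 to n.

Let a, b be the ends of a diametral path of length d. Deleting them leaves a tree with the same
distances, in which eccentricities drop by at most 1; this unit costs `farTotal` of the smaller
tree, bounded along the way by `cubic`. The terms involving a or b are estimated exactly on the path
and crudely at each of the k = n − 1 − d other vertices (`exists_recursion`). For k = 0 the estimate
is the recurrence satisfied by `quartic` (`quartic_add_two`); for k ≥ 1 it is strictly smaller
(`pathWeight_lt`). Equality thus forces d = n − 1, so T is a path. On P_n every estimate is an
equality, which gives its value. -/

open SimpleGraph Finset

/-! ### The difference of the indices as one sum -/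

/-- `gap t` is `t` except that `gap 1 = 0`, so that summing `gap (G.dist v u)` over `u` gives the
total distance of `v` minus its degree. -/
def gap (t : ℕ) : ℕ := if t = 1 then 0 else t

theorem gap_le (t : ℕ) : gap t ≤ t := by unfold gap; split_ifs <;> omega

theorem gap_of_two_le {t : ℕ} (h : 2 ≤ t) : gap t = t := by unfold gap; split_ifs <;> omega

/-- The total distance of `v` diminished by its degree, as a sum over vertices. -/
noncomputable def farSum {V : Type*} [Fintype V] (G : SimpleGraph V) (v : V) : ℕ :=
  ∑ u, gap (G.dist v u)

/-- The difference of the two indices, as a sum of natural numbers. -/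
noncomputable def eccFarSum {V : Type*} [Fintype V] (G : SimpleGraph V) : ℕ :=
  ∑ v, ecc G v * farSum G v

theorem totalDist_eq {V : Type*} [Fintype V] (G : SimpleGraph V) [DecidableRel G.Adj] (v : V) :
    totalDist G v = farSum G v + G.degree v := by
  classical
  have h : G.degree v = ∑ u, if G.Adj v u then 1 else 0 := by
    rw [← card_neighborFinset_eq_degree, neighborFinset_eq_filter, card_filter]
  rw [h, farSum, totalDist, ← sum_add_distrib]
  refine sum_congr rfl fun u _ => ?_
  have := dist_eq_one_iff_adj (G := G) (u := v) (v := u)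
  rw [gap]
  split_ifs <;> first | omega | tauto

theorem eccDistSum_eq {V : Type*} [Fintype V] (G : SimpleGraph V) [DecidableRel G.Adj] :
    eccDistSum G = eccFarSum G + eccConnIndex G := by
  rw [eccDistSum, eccFarSum, eccConnIndex, ← sum_add_distrib]
  exact sum_congr rfl fun v _ => by rw [totalDist_eq, mul_add]

theorem dist_map_iso {V W : Type*} {G : SimpleGraph V} {H : SimpleGraph W} (f : G ≃g H)
    (hG : G.Connected) (hH : H.Connected) (u v : V) : H.dist (f u) (f v) = G.dist u v := by
  apply le_antisymm
  · obtain ⟨p, hp⟩ := hG.exists_walk_length_eq_dist u v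
    rw [← hp, ← p.length_map f.toHom]
    exact dist_le _
  · obtain ⟨p, hp⟩ := hH.exists_walk_length_eq_dist (f u) (f v)
    have := dist_le (p.map f.symm.toHom)
    rw [Walk.length_map, hp] at this
    simpa using this

theorem eccFarSum_congr {V W : Type*} [Fintype V] [Fintype W] {G : SimpleGraph V}
    {H : SimpleGraph W} (f : G ≃g H) (hG : G.Connected) (hH : H.Connected) :
    eccFarSum G = eccFarSum H := by
  have hfar : ∀ v, farSum H (f v) = farSum G v := fun v => by
    rw [farSum, farSum, ← Equiv.sum_comp f.toEquiv]
    exact sum_congr rfl fun u _ => congrArg gap (dist_map_iso f hG hH v u)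
  have hecc : ∀ v, ecc H (f v) = ecc G v := fun v => by
    rw [ecc_eq_sup_dist H hH, ecc_eq_sup_dist G hG]
    apply le_antisymm
    · refine Finset.sup_le fun u _ => ?_
      obtain ⟨u, rfl⟩ := f.surjective u
      rw [dist_map_iso f hG hH]
      exact le_sup (f := fun u => G.dist v u) (mem_univ u)
    · refine Finset.sup_le fun u _ => ?_
      rw [← dist_map_iso f hG hH]
      exact le_sup (f := fun u => H.dist (f v) u) (mem_univ (f u))
  rw [eccFarSum, eccFarSum, ← Equiv.sum_comp f.toEquiv]
  exact sum_congr rfl fun v _ => by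
    have h1 := hfar v
    have h2 := hecc v
    simp only [RelIso.coe_fn_toEquiv] at *
    rw [h1, h2]

theorem dist_le_ecc {V : Type*} [Fintype V] {G : SimpleGraph V} (hG : G.Connected) (v u : V) :
    G.dist v u ≤ ecc G v := by
  rw [ecc_eq_sup_dist G hG]
  exact le_sup (f := fun u => G.dist v u) (mem_univ u)

theorem ecc_le {V : Type*} [Fintype V] {G : SimpleGraph V} (hG : G.Connected) (v : V) {m : ℕ}
    (h : ∀ u, G.dist v u ≤ m) : ecc G v ≤ m := by
  rw [ecc_eq_sup_dist G hG]
  exact Finset.sup_le fun u _ => h u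

/-! ### Distances and diametral paths in trees -/

section Tree

variable {V : Type*} {T : SimpleGraph V}

theorem length_eq_dist_of_isPath (hT : T.IsTree) {u v : V} {p : T.Walk u v} (hp : p.IsPath) :
    p.length = T.dist u v := by
  obtain ⟨q, hq, h⟩ := hT.1.exists_path_of_dist u v
  rw [← h]
  exact congrArg (fun r : T.Path u v => r.1.length) ((hT.2.subsingleton_path u v).elim ⟨p, hp⟩ ⟨q, hq⟩)

theorem dist_add_dist_of_mem_support (hT : T.IsTree) {u v x : V} {p : T.Walk u v}
    (hp : p.IsPath) (hx : x ∈ p.support) : T.dist u x + T.dist x v = T.dist u v := by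
  classical
  rw [← length_eq_dist_of_isPath hT hp, ← length_eq_dist_of_isPath hT (hp.takeUntil hx),
    ← length_eq_dist_of_isPath hT (hp.dropUntil hx), ← Walk.length_append, Walk.take_spec]

/-- A vertex on the path between `u` and `v` lies on every walk between them. -/
theorem mem_support_of_dist_add_dist (hT : T.IsTree) {u v x : V}
    (hx : T.dist u x + T.dist x v = T.dist u v) (q : T.Walk u v) : x ∈ q.support := by
  classical
  obtain ⟨p, hp⟩ := hT.1.exists_walk_length_eq_dist u x
  obtain ⟨r, hr⟩ := hT.1.exists_walk_length_eq_dist x v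
  have hpath : (p.append r).IsPath :=
    Walk.isPath_of_length_eq_dist _ (by rw [Walk.length_append, hp, hr, hx])
  have h : p.append r = q.bypass :=
    congrArg Subtype.val ((hT.2.subsingleton_path u v).elim ⟨_, hpath⟩ ⟨_, q.bypass_isPath⟩)
  refine q.support_bypass_subset_support ?_
  rw [← h, Walk.mem_support_append_iff]
  exact Or.inl p.end_mem_support

/-- If `x` lies between `u` and `v` in a tree, then for every `w` it lies between `u` and `w` or
between `v` and `w`. -/
theorem between_or_between (hT : T.IsTree) {u v x : V}
    (hx : T.dist u x + T.dist x v = T.dist u v) (w : V) :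
    T.dist u x + T.dist x w = T.dist u w ∨ T.dist v x + T.dist x w = T.dist v w := by
  obtain ⟨p, hp, -⟩ := hT.1.exists_path_of_dist u w
  obtain ⟨q, hq, -⟩ := hT.1.exists_path_of_dist v w
  -- The walk from u to v through w must meet x.
  have := mem_support_of_dist_add_dist hT hx (p.append q.reverse)
  rw [Walk.mem_support_append_iff, Walk.support_reverse, List.mem_reverse] at this
  exact this.imp (dist_add_dist_of_mem_support hT hp) (dist_add_dist_of_mem_support hT hq)

theorem two_le_dist_of_forall_le (hT : T.IsTree) [Fintype V] (hV : 3 ≤ Fintype.card V) {d : ℕ}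
    (h : ∀ u v, T.dist u v ≤ d) : 2 ≤ d := by
  by_contra! hd
  obtain ⟨x, y, z, hxy, hxz, hyz⟩ := Fintype.two_lt_card_iff.1 hV
  have key : ∀ {u v}, u ≠ v → T.dist u v = 1 := fun {u v} huv => by
    have h1 := hT.1.pos_dist_of_ne huv
    have h2 := h u v
    omega
  exact hT.dist_ne_of_adj z (dist_eq_one_iff_adj.1 (key hxy))
    ((key hxz.symm).trans (key hyz.symm).symm)

theorem exists_diametral [Fintype V] [Nonempty V] (T : SimpleGraph V) :
    ∃ a b, ∀ u v, T.dist u v ≤ T.dist a b := by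
  obtain ⟨x, -, hx⟩ := exists_max_image (univ : Finset (V × V)) (fun x => T.dist x.1 x.2)
    univ_nonempty
  exact ⟨x.1, x.2, fun u v => hx (u, v) (mem_univ _)⟩

/-- A vertex that is an end of a diametral path is not interior to any path. -/
theorem notMem_support_of_diametral (hT : T.IsTree) {a b u v : V}
    (h : ∀ u v, T.dist u v ≤ T.dist a b) (hu : u ≠ a) (hv : v ≠ a) {p : T.Walk u v}
    (hp : p.IsPath) : a ∉ p.support := by
  intro ha
  have h1 := hT.1.pos_dist_of_ne hu
  have h2 := hT.1.pos_dist_of_ne hv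
  have h3 := h u b
  have h4 := h v b
  -- If a were interior, u or v would be farther from b than a is.
  rcases between_or_between hT (dist_add_dist_of_mem_support hT hp ha) b with h5 | h5 <;> omega

/-- An embedding carries paths to paths, and every path in a tree is a geodesic. -/
theorem dist_of_embedding {W : Type*} {S : SimpleGraph W} (hT : T.IsTree) (hS : S.IsTree)
    (f : S ↪g T) (u v : W) : T.dist (f u) (f v) = S.dist u v := by
  obtain ⟨p, hp, h⟩ := hS.1.exists_path_of_dist u v
  have := length_eq_dist_of_isPath hT (hp.map (f := f.toHom) f.injective)
  rw [Walk.length_map, h] at this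
  exact this.symm

theorem isTree_induce_of_diametral (hT : T.IsTree) {a b c : V} (hca : c ≠ a)
    (hcb : c ≠ b) (h : ∀ u v, T.dist u v ≤ T.dist a b) :
    (T.induce {v | v ≠ a ∧ v ≠ b}).IsTree := by
  have hc : Nonempty {v | v ≠ a ∧ v ≠ b} := ⟨⟨c, hca, hcb⟩⟩
  refine ⟨⟨fun u v => ?_⟩, hT.2.induce _⟩
  obtain ⟨p, hp, -⟩ := hT.1.exists_path_of_dist u.1 v.1
  refine ⟨p.induce {v | v ≠ a ∧ v ≠ b} fun x hx => ⟨?_, ?_⟩⟩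
  · rintro rfl
    exact notMem_support_of_diametral hT h u.2.1 v.2.1 hp hx
  · rintro rfl
    exact notMem_support_of_diametral hT (fun u v => (h u v).trans_eq T.dist_comm)
      u.2.2 v.2.2 hp hx

theorem dist_getVert_le (hT : T.IsTree) {a b : V} (p : T.Walk a b) {i j : ℕ}
    (hij : i ≤ j) (hj : j ≤ p.length) : T.dist (p.getVert i) (p.getVert j) ≤ j - i := by
  induction j, hij using Nat.le_induction with
  | base => simp
  | succ j hij ih =>
    have h1 := hT.1.dist_triangle (u := p.getVert i) (v := p.getVert j) (w := p.getVert (j + 1))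
    have h2 := dist_eq_one_iff_adj.2 (p.adj_getVert_succ (i := j) (by omega))
    have h3 := ih (by omega)
    omega

/-- The upper bounds for the three segments add up to the distance from a to b, so each is attained.
-/
theorem dist_getVert (hT : T.IsTree) {a b : V} {p : T.Walk a b} (hp : p.length = T.dist a b)
    {i j : ℕ} (hij : i ≤ j) (hj : j ≤ p.length) :
    T.dist (p.getVert i) (p.getVert j) = j - i := by
  have h1 := dist_getVert_le hT p (Nat.zero_le i) (hij.trans hj)
  have h2 := dist_getVert_le hT p hij hj
  have h3 := dist_getVert_le hT p hj le_rfl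
  rw [p.getVert_zero] at h1
  rw [p.getVert_length] at h3
  have h4 := hT.1.dist_triangle (u := a) (v := p.getVert i) (w := b)
  have h5 := hT.1.dist_triangle (u := p.getVert i) (v := p.getVert j) (w := b)
  omega

/-- A tree whose diameter is one less than its order is a path. -/
theorem nonempty_iso_pathGraph [Fintype V] (hT : T.IsTree) {a b : V} {n : ℕ}
    (hn : Fintype.card V = n) (hab : T.dist a b + 1 = n) : Nonempty (T ≃g pathGraph n) := by
  obtain ⟨p, hp, hl⟩ := hT.1.exists_path_of_dist a b
  have hd : ∀ i < n, ∀ j < n, i ≤ j → T.dist (p.getVert i) (p.getVert j) = j - i :=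
    fun i hi j hj hij => dist_getVert hT hl hij (by omega)
  have hinj : Function.Injective fun i : Fin n => p.getVert i := fun i j hij => by
    apply Fin.ext
    apply hp.getVert_injOn _ _ hij
    · have := i.2; show (i : ℕ) ≤ _; omega
    · have := j.2; show (j : ℕ) ≤ _; omega
  have hbij := (Fintype.bijective_iff_injective_and_card _).2 ⟨hinj, by simp [hn]⟩
  refine ⟨(RelIso.symm ⟨Equiv.ofBijective _ hbij, ?_⟩)⟩
  intro i j
  rw [← dist_eq_one_iff_adj, pathGraph_adj]
  have hi := i.2
  have hj := j.2
  simp only [Equiv.ofBijective_apply]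
  rcases le_total (i : ℕ) j with h | h
  · rw [hd i hi j hj h]; omega
  · rw [dist_comm, hd j hj i hi h]; omega

end Tree

/-! ### Summation tools and eccentricities on a diametral path -/

theorem two_mul_sum_gap {d : ℕ} (hd : 1 ≤ d) :
    2 * ∑ i ∈ range (d + 1), gap i + 2 = d * (d + 1) := by
  induction d, hd using Nat.le_induction with
  | base => decide
  | succ d hd ih =>
    rw [sum_range_succ, gap_of_two_le (by omega)]
    linarith

theorem sum_eq_add_sum_subtype {V : Type*} [Fintype V] {a b : V} (hab : a ≠ b)
    [Fintype {v | v ≠ a ∧ v ≠ b}] (φ : V → ℕ) :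
    ∑ v, φ v = φ a + φ b + ∑ v : {v | v ≠ a ∧ v ≠ b}, φ v := by
  classical
  have h : (univ : Finset V) = insert a (insert b (univ.filter fun v => v ≠ a ∧ v ≠ b)) := by
    ext v
    simp only [mem_univ, mem_insert, mem_filter, true_and, true_iff]
    tauto
  rw [h, sum_insert (by simp [hab]), sum_insert (by simp), add_assoc,
    sum_subtype (p := fun v => v ∈ {v | v ≠ a ∧ v ≠ b}) _ (by simp)]

/-- Split a sum into the vertices listed by `p` and the others. -/
theorem sum_le_sum_range_add {V : Type*} [Fintype V] {p : ℕ → V} {m : ℕ}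
    (hp : Set.InjOn p (range m)) {φ : V → ℕ} {C : ℕ} (hφ : ∀ v, φ v ≤ C) :
    ∑ v, φ v ≤ ∑ i ∈ range m, φ (p i) + (Fintype.card V - m) * C := by
  classical
  rw [← sum_add_sum_compl ((range m).image p), sum_image hp]
  refine Nat.add_le_add_left ((sum_le_card_nsmul _ _ C fun v _ => hφ v).trans_eq ?_) _
  rw [card_compl, card_image_of_injOn hp, card_range, smul_eq_mul]

/-- The sum of `farSum` over all vertices. -/
noncomputable def farTotal {V : Type*} [Fintype V] (G : SimpleGraph V) : ℕ :=
  ∑ v, farSum G v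

/-- An upper bound for the eccentricity of an inner vertex of a diametral path. -/
theorem ecc_le_of_between {V : Type*} [Fintype V] {T : SimpleGraph V} (hT : T.IsTree) {a b x : V}
    (h : ∀ u v, T.dist u v ≤ T.dist a b) (hx : T.dist a x + T.dist x b = T.dist a b) :
    ecc T x ≤ max (T.dist a x) (T.dist x b) := by
  refine ecc_le hT.1 x fun u => ?_
  have h1 := h a u
  have h2 := h b u
  have h3 := T.dist_comm (u := b) (v := x)
  rw [le_max_iff]
  -- x separates u from an end; the rest of the diameter beyond x bounds the distance from x to u.
  rcases between_or_between hT hx u with h4 | h4 <;> omega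

/-! ### Deleting both ends of a diametral path -/

section Step

variable {V : Type*} [Fintype V] {T : SimpleGraph V} {a b : V}

theorem farSum_induce (hT : T.IsTree) (hab : a ≠ b) {s : Set V} [Fintype s]
    (hs : s = {v | v ≠ a ∧ v ≠ b}) (hT' : (T.induce s).IsTree) (v : s) :
    farSum T v = farSum (T.induce s) v + (gap (T.dist v a) + gap (T.dist v b)) := by
  subst hs
  rw [farSum, sum_eq_add_sum_subtype hab, add_comm]
  congr 1
  exact sum_congr rfl fun u _ =>
    congrArg gap (dist_of_embedding hT hT' (Embedding.induce _) v u)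

theorem ecc_induce_le (hT : T.IsTree) {s : Set V} [Fintype s]
    (hs : ∀ u, u ∉ s → ∃ w ∈ s, T.dist w u ≤ 1) (hT' : (T.induce s).IsTree) (v : s) :
    ecc T v ≤ ecc (T.induce s) v + 1 := by
  refine ecc_le hT.1 _ fun u => ?_
  have key : ∀ w : s, T.dist v w ≤ ecc (T.induce s) v := fun w =>
    (dist_of_embedding hT hT' (Embedding.induce _) v w).trans_le (dist_le_ecc hT'.1 v w)
  by_cases hu : u ∈ s
  · exact (key ⟨u, hu⟩).trans (Nat.le_succ _)
  · obtain ⟨w, hw, hwu⟩ := hs u hu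
    exact hT.1.dist_triangle.trans (add_le_add (key ⟨w, hw⟩) hwu)

theorem sum_gap_dist (a : V) : ∑ v, gap (T.dist v a) = farSum T a :=
  sum_congr rfl fun v _ => by rw [dist_comm]

/-- The ordered pairs (a, b) and (b, a) are counted twice on the right; `2 * T.dist a b`
compensates. -/
theorem farTotal_induce (hT : T.IsTree) (hab : 2 ≤ T.dist a b) {s : Set V} [Fintype s]
    (hs : s = {v | v ≠ a ∧ v ≠ b}) (hT' : (T.induce s).IsTree) :
    farTotal T + 2 * T.dist a b = farTotal (T.induce s) + 2 * (farSum T a + farSum T b) := by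
  have hne : a ≠ b := by rintro rfl; simp at hab
  have h1 : farTotal T = farSum T a + farSum T b + ∑ v : s, farSum T v := by
    subst hs; exact sum_eq_add_sum_subtype hne _
  have h2 : ∑ v, (gap (T.dist v a) + gap (T.dist v b)) =
      gap (T.dist a b) + gap (T.dist b a) +
        ∑ v : s, (gap (T.dist v a) + gap (T.dist v b)) := by
    subst hs; rw [sum_eq_add_sum_subtype hne]; simp [gap, add_comm]
  rw [sum_add_distrib, sum_gap_dist, sum_gap_dist, T.dist_comm (u := b), gap_of_two_le hab] at h2
  rw [sum_congr rfl fun v _ => farSum_induce hT hne hs hT' v, sum_add_distrib] at h1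
  rw [farTotal.eq_1 (T.induce s)]
  omega

theorem eccFarSum_induce_le (hT : T.IsTree) (hab : 2 ≤ T.dist a b)
    (h : ∀ u v, T.dist u v ≤ T.dist a b) {s : Set V} [Fintype s]
    (hs : s = {v | v ≠ a ∧ v ≠ b}) (hT' : (T.induce s).IsTree)
    (hs' : ∀ u, u ∉ s → ∃ w ∈ s, T.dist w u ≤ 1) :
    eccFarSum T + 2 * T.dist a b ^ 2 ≤ eccFarSum (T.induce s) + farTotal (T.induce s) +
      ∑ v, ecc T v * (gap (T.dist v a) + gap (T.dist v b)) +
      T.dist a b * (farSum T a + farSum T b) := by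
  have hne : a ≠ b := by rintro rfl; simp at hab
  have hea : ecc T a = T.dist a b :=
    le_antisymm (ecc_le hT.1 a fun u => h a u) (dist_le_ecc hT.1 a b)
  have heb : ecc T b = T.dist a b :=
    le_antisymm (ecc_le hT.1 b fun u => h b u) (T.dist_comm (u := b) ▸ dist_le_ecc hT.1 b a)
  have h1 : eccFarSum T = ecc T a * farSum T a + ecc T b * farSum T b +
      ∑ v : s, ecc T v * farSum T v := by
    subst hs; exact sum_eq_add_sum_subtype hne _
  have h2 : ∑ v, ecc T v * (gap (T.dist v a) + gap (T.dist v b)) =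
      ecc T a * gap (T.dist a b) + ecc T b * gap (T.dist b a) +
        ∑ v : s, ecc T v * (gap (T.dist v a) + gap (T.dist v b)) := by
    subst hs; rw [sum_eq_add_sum_subtype hne]; simp [gap]
  rw [T.dist_comm (u := b), gap_of_two_le hab, hea, heb] at h2
  rw [sum_congr rfl fun v _ => congrArg _ (farSum_induce hT hne hs hT' v), hea, heb] at h1
  simp only [mul_add, sum_add_distrib] at h1 h2 ⊢
  have h3 : ∑ v : s, ecc T v * farSum (T.induce s) v ≤
      eccFarSum (T.induce s) + farTotal (T.induce s) := by
    rw [eccFarSum, farTotal, ← sum_add_distrib]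
    refine sum_le_sum fun v _ => ?_
    calc _ ≤ (ecc (T.induce s) v + 1) * farSum (T.induce s) v :=
          Nat.mul_le_mul_right _ (ecc_induce_le hT hs' hT' v)
      _ = _ := by ring
  rw [pow_two]
  linarith

/-- The contribution of a diametral path of length `d` to the sum of eccentricities, weighted with
the distances to its ends. -/
def pathWeight (d : ℕ) : ℕ := ∑ i ∈ range (d + 1), max i (d - i) * (gap i + gap (d - i))

/-- Here k counts the vertices off the diametral path. Each has distance at most d to both ends and
eccentricity at most d; half of 4kd² comes from its own eccentricity, half from those of a and b. -/
theorem exists_recursion (hT : T.IsTree) (hV : 3 ≤ Fintype.card V) :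
    ∃ (W : Set V) (_ : Fintype W) (d k : ℕ), (T.induce W).IsTree ∧
      Fintype.card W + 2 = Fintype.card V ∧ Fintype.card V = d + 1 + k ∧ 2 ≤ d ∧
      (∃ a b, T.dist a b = d) ∧
      farTotal T + 2 * d + 4 ≤ farTotal (T.induce W) + 2 * (d * (d + 1)) + 4 * (k * d) ∧
      eccFarSum T + 2 * d ^ 2 + 2 * d ≤ eccFarSum (T.induce W) + farTotal (T.induce W) +
        pathWeight d + 4 * (k * d ^ 2) + d * (d * (d + 1)) := by
  classical
  have : Nonempty V := Fintype.card_pos_iff.1 (by omega)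
  obtain ⟨a, b, h⟩ := exists_diametral T
  obtain ⟨p, hp, hl⟩ := hT.1.exists_path_of_dist a b
  have hd := two_le_dist_of_forall_le hT hV h
  have hne : a ≠ b := by rintro rfl; simp at hd
  have ha : ∀ i ≤ T.dist a b, T.dist (p.getVert i) a = i := fun i hi => by
    rw [dist_comm]
    simpa using dist_getVert hT hl (Nat.zero_le i) (by omega)
  have hb : ∀ i ≤ T.dist a b, T.dist (p.getVert i) b = T.dist a b - i := fun i hi => by
    have := dist_getVert hT hl (i := i) (j := p.length) (by omega) le_rfl
    rwa [p.getVert_length, hl] at this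
  have hinj : Set.InjOn p.getVert (range (T.dist a b + 1)) := fun i hi j hj hij => by
    simp only [coe_range, Set.mem_Iio] at hi hj
    rw [← ha i (by omega), ← ha j (by omega), hij]
  have hcard : T.dist a b + 1 ≤ Fintype.card V := by
    rw [← card_range (T.dist a b + 1), ← card_image_of_injOn hinj]
    exact card_le_univ _
  have hmem : ∀ i, 1 ≤ i → i + 1 ≤ T.dist a b → p.getVert i ∈ {v | v ≠ a ∧ v ≠ b} :=
    fun i h1 h2 => by
      have h3 := ha i (by omega)
      have h4 := hb i (by omega)
      refine ⟨fun h => ?_, fun h => ?_⟩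
      · rw [h, dist_self] at h3; omega
      · rw [h, dist_self] at h4; omega
  have hT' : (T.induce {v | v ≠ a ∧ v ≠ b}).IsTree :=
    isTree_induce_of_diametral hT (hmem 1 le_rfl hd).1 (hmem 1 le_rfl hd).2 h
  have hs' : ∀ u, u ∉ {v | v ≠ a ∧ v ≠ b} → ∃ w ∈ {v | v ≠ a ∧ v ≠ b}, T.dist w u ≤ 1 := by
    intro u hu
    by_cases hua : u = a
    · exact ⟨_, hmem 1 le_rfl hd, by rw [hua, ha 1 (by omega)]⟩
    · have hub : u = b := by
        by_contra hub
        exact hu ⟨hua, hub⟩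
      exact ⟨_, hmem (T.dist a b - 1) (by omega) (by omega), by
        rw [hub, hb _ (by omega)]; omega⟩
  have hA : 2 * farSum T a + 2 ≤ T.dist a b * (T.dist a b + 1) +
      2 * ((Fintype.card V - (T.dist a b + 1)) * T.dist a b) := by
    rw [← two_mul_sum_gap (d := T.dist a b) (by omega), ← sum_gap_dist]
    have := sum_le_sum_range_add hinj (φ := fun v => gap (T.dist v a))
      (fun v => (gap_le _).trans (h v a))
    rw [sum_congr rfl fun i hi => congrArg gap (ha i (by simpa [Nat.lt_succ_iff] using hi))] at this
    omega
  have hB : 2 * farSum T b + 2 ≤ T.dist a b * (T.dist a b + 1) +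
      2 * ((Fintype.card V - (T.dist a b + 1)) * T.dist a b) := by
    rw [← two_mul_sum_gap (d := T.dist a b) (by omega), ← sum_gap_dist]
    have := sum_le_sum_range_add hinj (φ := fun v => gap (T.dist v b))
      (fun v => (gap_le _).trans (h v b))
    rw [sum_congr rfl fun i hi => congrArg gap (hb i (by simpa [Nat.lt_succ_iff] using hi)),
      sum_flip gap] at this
    omega
  have hR : ∑ v, ecc T v * (gap (T.dist v a) + gap (T.dist v b)) ≤ pathWeight (T.dist a b) +
      (Fintype.card V - (T.dist a b + 1)) * (T.dist a b * (2 * T.dist a b)) := by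
    refine (sum_le_sum_range_add hinj
      (φ := fun v => ecc T v * (gap (T.dist v a) + gap (T.dist v b)))
      (C := T.dist a b * (2 * T.dist a b)) fun v => ?_).trans ?_
    · refine Nat.mul_le_mul (ecc_le hT.1 v fun u => h v u) ?_
      have h1 := (gap_le _).trans (h v a)
      have h2 := (gap_le _).trans (h v b)
      omega
    · refine Nat.add_le_add_right (sum_le_sum fun i hi => ?_) _
      have hi : i ≤ T.dist a b := by simpa [Nat.lt_succ_iff] using hi
      have hai := ha i hi
      have hbi := hb i hi
      rw [hai, hbi]
      refine Nat.mul_le_mul_right _ ?_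
      refine (ecc_le_of_between hT h (x := p.getVert i) ?_).trans_eq ?_
      · rw [dist_comm, hai, hbi]; omega
      · rw [T.dist_comm (u := a), hai, hbi]
  have hF := eccFarSum_induce_le hT hd h rfl hT' hs'
  have hG := farTotal_induce hT hd rfl hT'
  have hc := sum_eq_add_sum_subtype hne (fun _ => 1)
  simp only [sum_const, card_univ, smul_eq_mul, mul_one] at hc
  obtain ⟨k, hk⟩ := Nat.exists_eq_add_of_le hcard
  refine ⟨{v | v ≠ a ∧ v ≠ b}, inferInstance, T.dist a b, k, hT', by omega, hk, hd,
    ⟨a, b, rfl⟩, ?_, ?_⟩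
  · rw [hk, Nat.add_sub_cancel_left] at hA hB
    linarith
  · rw [hk, Nat.add_sub_cancel_left] at hA hB hR
    have hAB : T.dist a b * (farSum T a + farSum T b) + 2 * T.dist a b ≤
        T.dist a b * (T.dist a b * (T.dist a b + 1)) + 2 * (k * T.dist a b ^ 2) := by
      have := Nat.mul_le_mul_left (T.dist a b) (show farSum T a + farSum T b + 2 ≤
        T.dist a b * (T.dist a b + 1) + 2 * (k * T.dist a b) by linarith)
      linarith
    linarith

end Step

/-! ### Closed forms and the numerical comparison -/

theorem four_mul_sum_max (d : ℕ) :
    4 * ∑ i ∈ range (d + 1), max i (d - i) = 3 * d ^ 2 + 4 * d + d % 2 := by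
  induction d using Nat.twoStepInduction with
  | zero => decide
  | one => decide
  | more d ih _ =>
    have h : ∀ i ∈ range (d + 1), max (i + 1) (d + 2 - (i + 1)) = max i (d - i) + 1 :=
      fun i _ => by omega
    rw [sum_range_succ, sum_range_succ', sum_congr rfl h, sum_add_distrib]
    simp only [sum_const, card_range, smul_eq_mul]
    have h1 : (d + 2) % 2 = d % 2 := by omega
    rw [h1, Nat.sub_self, Nat.sub_zero, Nat.max_zero, Nat.zero_max]
    linarith

/-- The two gaps add up to d except for a loss of 1 at i = 1 and at i = d − 1, each with maximum d −
1; for d = 2 both losses fall on the same index. -/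
theorem pathWeight_add {d : ℕ} (hd : 2 ≤ d) :
    pathWeight d + 2 * (d - 1) = d * ∑ i ∈ range (d + 1), max i (d - i) := by
  have h1 : ∑ i ∈ range (d + 1), (if i = 1 then max i (d - i) else 0) = d - 1 := by
    rw [sum_ite_eq' (range (d + 1)) 1, if_pos (by simp; omega)]; omega
  have h2 : ∑ i ∈ range (d + 1), (if i = d - 1 then max i (d - i) else 0) = d - 1 := by
    rw [sum_ite_eq' (range (d + 1)) (d - 1), if_pos (by simp)]; omega
  rw [two_mul, ← add_assoc]
  nth_rewrite 2 [← h1]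
  rw [← h2, pathWeight, ← sum_add_distrib, ← sum_add_distrib, mul_sum]
  refine sum_congr rfl fun i hi => ?_
  have hi : i ≤ d := by simpa [Nat.lt_succ_iff] using hi
  obtain ⟨j, rfl⟩ := Nat.exists_eq_add_of_le hi
  rw [Nat.add_sub_cancel_left]
  generalize max i j = M
  unfold gap
  split_ifs <;> first | omega | (subst_vars; ring_nf)

theorem four_mul_pathWeight {d : ℕ} (hd : 2 ≤ d) :
    (4 * pathWeight d : ℚ) = 3 * d ^ 3 + 4 * d ^ 2 + (d % 2 : ℕ) * d - 8 * (d - 1) := by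
  have h1 := pathWeight_add hd
  have h2 := four_mul_sum_max d
  obtain ⟨e, rfl⟩ := Nat.exists_eq_add_of_le' hd
  rw [show e + 2 - 1 = e + 1 by omega] at h1
  have h3 : ((pathWeight (e + 2) + 2 * (e + 1) : ℕ) : ℚ) = _ := congrArg Nat.cast h1
  have h4 := congrArg (Nat.cast (R := ℚ)) h2
  push_cast at h3 h4 ⊢
  linear_combination 4 * h3 + (e + 2) * h4

/-- The value of `farTotal` on the path with `n` vertices. -/
def cubic (n : ℕ) : ℚ := ((n : ℚ) ^ 3 - n) / 3 - 2 * (n - 1)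

/-- The right side is the tree recursion with k = 0 and d = n + 1. -/
theorem quartic_add_two {n : ℕ} (hn : 1 ≤ n) :
    quartic (n + 2) = quartic n + cubic n + pathWeight (n + 1) + ((n : ℚ) + 1) ^ 2 * (n + 2) -
      2 * (n + 1) ^ 2 - 2 * (n + 1) := by
  have h := four_mul_pathWeight (d := n + 1) (by omega)
  unfold quartic cubic
  rcases Nat.even_or_odd n with hp | hp
  · have h1 : ¬ Odd n := Nat.not_odd_iff_even.2 hp
    have h2 : ¬ Odd (n + 2) := by rw [Nat.odd_iff] at *; omega
    have h3 : (n + 1) % 2 = 1 := by rw [Nat.even_iff] at hp; omega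
    rw [h3] at h
    rw [if_neg h1, if_neg h2]
    push_cast at h ⊢
    linear_combination - h / 4
  · have h2 : Odd (n + 2) := by rw [Nat.odd_iff] at *; omega
    have h3 : (n + 1) % 2 = 0 := by rw [Nat.odd_iff] at hp; omega
    rw [h3] at h
    rw [if_pos hp, if_pos h2]
    push_cast at h ⊢
    linear_combination - h / 4

/-- The recursion for trees gives the largest value when the diametral path is spanning. -/
theorem pathWeight_lt {d k : ℕ} (hd : 2 ≤ d) (hk : 1 ≤ k) :
    (pathWeight d : ℚ) + 4 * (k * d ^ 2) + d * (d * (d + 1)) - 2 * d ^ 2 - 2 * d <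
      pathWeight (d + k) + ((d : ℚ) + k) ^ 2 * (d + k + 1) - 2 * (d + k) ^ 2 - 2 * (d + k) := by
  have h1 := four_mul_pathWeight hd
  have h2 := four_mul_pathWeight (d := d + k) (by omega)
  have h3 : ((d % 2 : ℕ) : ℚ) * d ≤ 1 * d :=
    mul_le_mul_of_nonneg_right (by exact_mod_cast Nat.le_of_lt_succ (Nat.mod_lt d two_pos))
      (Nat.cast_nonneg d)
  have h4 : (0 : ℚ) ≤ ((d + k) % 2 : ℕ) * (d + k : ℕ) := by positivity
  -- Four times the difference of the two sides, after bounding the parity term of d by d and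
  -- dropping that of d + k.
  have h5 : (16 * k + d : ℚ) < 5 * d ^ 2 * k + 21 * d * k ^ 2 + 7 * k ^ 3 := by
    norm_cast
    nlinarith [Nat.mul_le_mul hd hk, Nat.mul_le_mul (Nat.mul_le_mul hd hd) (le_refl k),
      Nat.mul_le_mul (le_refl d) (Nat.mul_le_mul hk hk), Nat.pow_pos (n := 3) hk]
  push_cast at *
  linarith

/-! ### The induction over trees -/

theorem bounds (n : ℕ) : ∀ {V : Type*} [Fintype V] (T : SimpleGraph V), T.IsTree →
    Fintype.card V = n → (farTotal T : ℚ) ≤ cubic n ∧ (eccFarSum T : ℚ) ≤ quartic n ∧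
      ((eccFarSum T : ℚ) = quartic n → ∃ a b, T.dist a b + 1 = n) := by
  induction n using Nat.strong_induction_on with
  | _ n ih =>
  intro V _ T hT hV
  rcases Nat.lt_or_ge n 3 with hn | hn
  -- With at most two vertices all distances are at most 1, so every gap vanishes.
  · have hlt : ∀ u v, T.dist u v < n := fun u v => by
      obtain ⟨p, hp, h⟩ := hT.1.exists_path_of_dist u v
      rw [← h, ← hV]
      exact hp.length_lt
    have hfar : ∀ v, farSum T v = 0 := fun v => sum_eq_zero fun u _ => by
      have := hlt v u
      unfold gap
      split_ifs <;> omega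
    have h1 : farTotal T = 0 := sum_eq_zero fun v _ => hfar v
    have h2 : eccFarSum T = 0 := sum_eq_zero fun v _ => by rw [hfar, mul_zero]
    obtain ⟨a⟩ := hT.1.nonempty
    have hpos := hlt a a
    rw [dist_self] at hpos
    obtain rfl | rfl : n = 1 ∨ n = 2 := by omega
    · have hq : quartic 1 = 0 := by rw [quartic, if_pos (by decide)]; norm_num
      rw [h1, h2, hq]
      exact ⟨by norm_num [cubic], by norm_num, fun _ => ⟨a, a, by simp⟩⟩
    · have hq : quartic 2 = 0 := by rw [quartic, if_neg (by decide)]; norm_num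
      rw [h1, h2, hq]
      have : Nontrivial V := Fintype.one_lt_card_iff_nontrivial.1 (by omega)
      obtain ⟨b, hb⟩ := exists_ne a
      have := hT.1.pos_dist_of_ne hb
      have := hlt b a
      exact ⟨by norm_num [cubic], by norm_num, fun _ => ⟨b, a, by omega⟩⟩
  · obtain ⟨W, _, d, k, hT', hW, hdk, hd, ⟨a, b, hab⟩, hG, hF⟩ := exists_recursion hT (hV ▸ hn)
    obtain ⟨m, rfl⟩ := Nat.exists_eq_add_of_le' (show 2 ≤ n by omega)
    obtain ⟨ihG, ihF, -⟩ := ih m (by omega) (T.induce W) hT' (by omega)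
    have hm : m + 1 = d + k := by omega
    have hmq : (m : ℚ) = d + k - 1 := by
      have : ((m + 1 : ℕ) : ℚ) = (d + k : ℕ) := congrArg _ hm
      push_cast at this
      linarith
    have hG' : ((_ : ℕ) : ℚ) ≤ ((_ : ℕ) : ℚ) := Nat.cast_le.2 hG
    have hF' : ((_ : ℕ) : ℚ) ≤ ((_ : ℕ) : ℚ) := Nat.cast_le.2 hF
    have hq := quartic_add_two (n := m) (by omega)
    rw [hm] at hq
    push_cast at hG' hF'
    refine ⟨?_, ?_⟩
    -- The slack in the recursion for `farTotal` is 2k².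
    · have : (0 : ℚ) ≤ k ^ 2 := by positivity
      unfold cubic at ihG ⊢
      push_cast
      rw [hmq] at ihG ⊢
      nlinarith
    · rcases Nat.eq_zero_or_pos k with rfl | hk
      · refine ⟨?_, fun _ => ⟨a, b, by omega⟩⟩
        rw [show d + 0 = d from rfl] at hq
        rw [hq, hmq]
        push_cast at hF' ⊢
        linarith
      · have hlt : (eccFarSum T : ℚ) < quartic (m + 2) := by
          have := pathWeight_lt hd hk
          rw [hq, hmq]
          linarith
        exact ⟨hlt.le, fun h => absurd h hlt.ne⟩

/-! ### The value on the path graph -/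

theorem sub_le_length_pathGraph {n : ℕ} {i j : Fin n} (p : (pathGraph n).Walk i j) :
    (i : ℕ) - j + (j - i) ≤ p.length := by
  induction p with
  | nil => simp
  | cons h p ih =>
    rw [pathGraph_adj] at h
    rw [Walk.length_cons]
    omega

theorem dist_pathGraph_add_le {n : ℕ} (i k : ℕ) (h : i + k < n) :
    (pathGraph n).dist ⟨i, by omega⟩ ⟨i + k, h⟩ ≤ k := by
  induction k with
  | zero => simp
  | succ k ih =>
    have hadj : (pathGraph n).Adj ⟨i + k, by omega⟩ ⟨i + (k + 1), h⟩ :=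
      pathGraph_adj.2 (Or.inl rfl)
    have h1 := (pathGraph_preconnected n ⟨i, by omega⟩ ⟨i + k, by omega⟩).dist_triangle_left
      (⟨i + (k + 1), h⟩ : Fin n)
    rw [dist_eq_one_iff_adj.2 hadj] at h1
    exact h1.trans (Nat.add_le_add_right (ih (by omega)) 1)

theorem dist_pathGraph {n : ℕ} (i j : Fin n) :
    (pathGraph n).dist i j = (i : ℕ) - j + (j - i) := by
  apply le_antisymm
  · rcases le_total (i : ℕ) j with h | h
    · obtain ⟨k, hk⟩ := Nat.exists_eq_add_of_le h
      have := dist_pathGraph_add_le (n := n) i k (by omega)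
      simp only [← hk, Fin.eta] at this
      omega
    · obtain ⟨k, hk⟩ := Nat.exists_eq_add_of_le h
      have := dist_pathGraph_add_le (n := n) j k (by omega)
      simp only [← hk, Fin.eta] at this
      rw [dist_comm]
      omega
  · obtain ⟨p, hp⟩ := (pathGraph_preconnected n i j).exists_walk_length_eq_dist
    rw [← hp]
    exact sub_le_length_pathGraph p

theorem ecc_pathGraph {m : ℕ} (i : Fin (m + 1)) : ecc (pathGraph (m + 1)) i = max (i : ℕ) (m - i) := by
  have hc := pathGraph_connected m
  have hi := i.2
  apply le_antisymm
  · refine ecc_le hc i fun j => ?_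
    have hj := j.2
    rw [dist_pathGraph]
    omega
  · have h1 := dist_le_ecc hc i 0
    have h2 := dist_le_ecc hc i (Fin.last m)
    rw [dist_pathGraph] at h1 h2
    simp only [Fin.val_zero, Fin.val_last] at h1 h2
    omega

/-- The sum of `gap` over the vertices on one side of a path. -/
def gapSum (m : ℕ) : ℕ := ∑ t ∈ range (m + 1), gap t

theorem farSum_pathGraph {m : ℕ} (i : Fin (m + 1)) :
    farSum (pathGraph (m + 1)) i = gapSum i + gapSum (m - i) := by
  obtain ⟨k, hk⟩ := Nat.exists_eq_add_of_le (Nat.le_of_lt_succ i.2)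
  rw [farSum, sum_congr rfl fun j _ => congrArg gap (dist_pathGraph i j),
    Fin.sum_univ_eq_sum_range (fun j => gap ((i : ℕ) - j + (j - i)))]
  generalize (i : ℕ) = l at hk ⊢
  subst hk
  rw [Nat.add_sub_cancel_left, gapSum, gapSum, sum_range_succ' _ k, add_right_comm, sum_range_add,
    ← sum_flip gap]
  rw [show gap 0 = 0 from rfl, add_zero]
  refine congrArg₂ _ (sum_congr rfl fun j hj => ?_) (sum_congr rfl fun j _ => ?_)
  · have hj : j ≤ l := by simpa [Nat.lt_succ_iff] using hj
    congr 1; omega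
  · congr 1; omega

theorem eccFarSum_pathGraph (m : ℕ) : eccFarSum (pathGraph (m + 1)) =
    ∑ i ∈ range (m + 1), max i (m - i) * (gapSum i + gapSum (m - i)) := by
  rw [eccFarSum, ← Fin.sum_univ_eq_sum_range (fun i => max i (m - i) * (gapSum i + gapSum (m - i)))]
  exact sum_congr rfl fun i _ => by rw [ecc_pathGraph, farSum_pathGraph]

theorem two_mul_gapSum {m : ℕ} (hm : 1 ≤ m) : 2 * gapSum m + 2 = m * (m + 1) :=
  two_mul_sum_gap hm

theorem six_mul_sum_gapSum (m : ℕ) :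
    6 * ∑ i ∈ range (m + 1), gapSum i + 6 * m = m * (m + 1) * (m + 2) := by
  induction m with
  | zero => rfl
  | succ m ih =>
    rw [sum_range_succ]
    have := two_mul_gapSum (m := m + 1) (by omega)
    linarith

theorem pathWeight_add_two (m : ℕ) : pathWeight (m + 2) =
    ∑ i ∈ range (m + 1), (max i (m - i) + 1) * (gap (i + 1) + gap (m - i + 1)) +
      2 * (m + 2) ^ 2 := by
  rw [pathWeight, sum_range_succ, sum_range_succ', Nat.sub_self, Nat.sub_zero, Nat.max_zero,
    Nat.zero_max, show gap 0 = 0 from rfl, gap_of_two_le (show 2 ≤ m + 2 by omega)]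
  rw [sum_congr rfl fun i hi => show _ = (max i (m - i) + 1) * (gap (i + 1) + gap (m - i + 1)) by
    have hi : i ≤ m := by simpa [Nat.lt_succ_iff] using hi
    rw [show m + 2 - (i + 1) = m - i + 1 by omega]
    congr 1; omega]
  ring

/-- Deleting both ends of a path lowers every inner eccentricity by exactly 1, so the recursion for
trees holds with equality. -/
theorem eccFarSum_pathGraph_add_two (m : ℕ) :
    eccFarSum (pathGraph (m + 3)) + 2 * (m + 2) ^ 2 = eccFarSum (pathGraph (m + 1)) +
      2 * ∑ i ∈ range (m + 1), gapSum i + pathWeight (m + 2) + 2 * ((m + 2) * gapSum (m + 2)) := by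
  rw [eccFarSum_pathGraph, eccFarSum_pathGraph, pathWeight_add_two, sum_range_succ,
    sum_range_succ', Nat.sub_self, Nat.sub_zero, Nat.max_zero, Nat.zero_max,
    show gapSum 0 = 0 from rfl]
  have h : ∀ i ∈ range (m + 1),
      max (i + 1) (m + 2 - (i + 1)) * (gapSum (i + 1) + gapSum (m + 2 - (i + 1))) =
      max i (m - i) * (gapSum i + gapSum (m - i)) + (gapSum i + gapSum (m - i)) +
        (max i (m - i) + 1) * (gap (i + 1) + gap (m - i + 1)) := fun i hi => by
    have hi : i ≤ m := by simpa [Nat.lt_succ_iff] using hi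
    have hs : ∀ j, gapSum (j + 1) = gapSum j + gap (j + 1) := fun j => sum_range_succ _ _
    rw [show m + 2 - (i + 1) = m - i + 1 by omega,
      show max (i + 1) (m - i + 1) = max i (m - i) + 1 by omega, hs, hs]
    ring
  rw [sum_congr rfl h, sum_add_distrib, sum_add_distrib,
    sum_add_distrib (f := fun i => gapSum i), sum_flip gapSum]
  ring

theorem eccFarSum_pathGraph_eq_quartic (m : ℕ) :
    (eccFarSum (pathGraph (m + 1)) : ℚ) = quartic (m + 1) := by
  induction m using Nat.twoStepInduction with
  | zero =>
    have h : eccFarSum (pathGraph (0 + 1)) = 0 := by rw [eccFarSum_pathGraph]; rfl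
    rw [h, quartic, if_pos (by decide)]
    norm_num
  | one =>
    have h : eccFarSum (pathGraph (1 + 1)) = 0 := by rw [eccFarSum_pathGraph]; rfl
    rw [h, quartic, if_neg (by decide)]
    norm_num
  | more m ih _ =>
    have h1 := congrArg (Nat.cast (R := ℚ)) (eccFarSum_pathGraph_add_two m)
    have h2 := congrArg (Nat.cast (R := ℚ)) (six_mul_sum_gapSum m)
    have h3 := congrArg (Nat.cast (R := ℚ)) (two_mul_gapSum (m := m + 2) (by omega))
    have h4 := quartic_add_two (n := m + 1) (by omega)
    unfold cubic at h4
    push_cast at h1 h2 h3 h4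
    rw [show m + 2 + 1 = m + 1 + 2 from rfl, h4]
    linear_combination h1 + ih + h2 / 3 + (m + 2) * h3

end EccDiff

theorem mainTheorem4 {V : Type*} [Fintype V] (T : SimpleGraph V) [DecidableRel T.Adj]
    (hT : T.IsTree) (n : ℕ) (hn : Fintype.card V = n) :
    (EccDiff.eccDistSum T : ℚ) - (EccDiff.eccConnIndex T : ℚ) ≤ EccDiff.quartic n ∧
    EccDiff.quartic n =
      (EccDiff.eccDistSum (SimpleGraph.pathGraph n) : ℚ) -
        (EccDiff.eccConnIndex (SimpleGraph.pathGraph n) : ℚ) ∧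
    ((EccDiff.eccDistSum T : ℚ) - (EccDiff.eccConnIndex T : ℚ) = EccDiff.quartic n ↔
      Nonempty (T ≃g SimpleGraph.pathGraph n)) := by
  rw [EccDiff.eccDistSum_eq, EccDiff.eccDistSum_eq, Nat.cast_add, Nat.cast_add,
    add_sub_cancel_right, add_sub_cancel_right]
  have hpos : 0 < n := hn ▸ Fintype.card_pos_iff.2 hT.1.nonempty
  obtain ⟨m, rfl⟩ := Nat.exists_eq_add_of_le' hpos
  obtain ⟨-, hle, heq⟩ := EccDiff.bounds _ T hT hn
  have hpath := EccDiff.eccFarSum_pathGraph_eq_quartic m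
  refine ⟨hle, hpath.symm, fun h => ?_, fun ⟨f⟩ => ?_⟩
  · obtain ⟨a, b, hab⟩ := heq h
    exact EccDiff.nonempty_iso_pathGraph hT hn hab
  · rw [← hpath, EccDiff.eccFarSum_congr f hT.1 (SimpleGraph.pathGraph_connected m)]
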